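/- Let $K\ge 3$ be an integer and let $\theta,p>0$ be real. Let $(Z_t)_{t\ge0}$ be the continuous-time Markov process on $\mathbb{Z}/K\mathbb{Z}\cup\{\partial\}$, absorbed at $\partial$ at the random time $\tau_p$, with generator $$\mathcal{G}f(x)=f(x+1)-f(x)+\theta\,[f(x-1)-f(x)]+p\,[f(\partial)-f(x)]\quad(x\in\mathbb{Z}/K\mathbb{Z}),\qquad \mathcal{G}f(\partial)=0.$$ A quasi-stationary distribution (QSD) of $Z$ is a probability $q$ on $\mathbb{Z}/K\mathbb{Z}$ such that $\mathbb{P}_q(Z_t=x\mid t<\tau_p)=q(x)$ for all $t\ge 0$ and all $x$. For $N\ge 2$ let $\mathcal{E}_{K,N}=\{\eta:\mathbb{Z}/K\mathbb{Z}\to\mathbb{N}:\ \sum_k\eta(k)=N\}$, and consider the continuous-time Markov process on $\mathcal{E}_{K,N}$ (the $N$-particle Fleming–Viot process) with generator $$\mathcal{L}_{K,N}f(\eta)=\sum_{i,j\in\mathbb{Z}/K\mathbb{Z}}\eta(i)\,[f(\eta-e_i+e_j)-f(\eta)]\Big(\mathbf 1_{\{j=i+1\}}+\theta\,\mathbf 1_{\{j=i-1\}}+p\,\frac{\eta(j)}{N-1}\Big),$$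 where $e_i$ is the indicator function of $\{i\}$ and terms with $\eta(i)=0$ are zero. For $\eta\in\mathcal{E}_{K,N}$ let $m(\eta)=\frac1N\sum_{k\in\mathbb{Z}/K\mathbb{Z}}\eta(k)\,\delta_k$ be the empirical distribution, and let $\|\mu-\nu\|_2=\big(\sum_k|\mu(k)-\nu(k)|^2\big)^{1/2}$. Then $Z$ has a unique QSD $\nu_{qs}$, which is the uniform distribution on $\mathbb{Z}/K\mathbb{Z}$; for every $N\ge2$ the $N$-particle process has a unique stationary distribution $\nu_N$; and, for fixed $K,\theta,p$, as $N\to\infty$, $$\mathbb{E}_{\nu_N}\big[\|m(\eta)-\nu_{qs}\|_2\big]\ \le\ \sqrt{\frac{K-1}{N}}\,\sqrt{1+\frac{p(K+1)}{6(1+\theta)}}+o\Big(\frac1{\sqrt N}\Big).$$ In particular, there is a constant $C$ depending only on $K,\theta,p$ such that $\mathbb{E}_{\nu_N}\big[\|m(\eta)-\nu_{qs}\|_2\big]\le C/\sqrt N$ for all $N\ge 2$. -/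

import Mathlib

namespace FlemingViot

/-! ## Continuous-time Markov chains on a finite state space -/

section MarkovChain

variable {S : Type*} [Fintype S] [DecidableEq S]

/-- The matrix `(L 1_y (x))_{x, y}` of a generator `L` acting on functions on a finite set. -/
def generatorMatrix (L : (S → ℝ) → S → ℝ) : Matrix S S ℝ :=
  Matrix.of fun x y => L (Pi.single y 1) x

/-- The law at time `t` of the Markov process with generator `L` and initial law `μ`:
the row vector `μ exp(t L)`. -/
noncomputable def lawAt (L : (S → ℝ) → S → ℝ) (μ : S → ℝ) (t : ℝ) : S → ℝ :=
  Matrix.vecMul μ (NormedSpace.exp (t • generatorMatrix L))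

/-- `ν` is a stationary distribution of the Markov process with generator `L`. -/
def IsStationary (L : (S → ℝ) → S → ℝ) (ν : S → ℝ) : Prop :=
  ν ∈ stdSimplex ℝ S ∧ ∀ t : ℝ, 0 ≤ t → lawAt L ν t = ν

end MarkovChain

/-! ## The killed asymmetric random walk on the cycle -/

/-- The generator of the asymmetric random walk on `ℤ/Kℤ` killed at rate `p`; the absorbing
state is `none`. -/
def killedGenerator (K : ℕ) (θ p : ℝ) (f : Option (ZMod K) → ℝ) : Option (ZMod K) → ℝ
  | none => 0
  | some x => f (some (x + 1)) - f (some x) + θ * (f (some (x - 1)) - f (some x))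
      + p * (f none - f (some x))

/-- A probability on `ℤ/Kℤ` seen as a probability on `ℤ/Kℤ ∪ {∂}`. -/
def extendByZero {K : ℕ} (q : ZMod K → ℝ) : Option (ZMod K) → ℝ
  | none => 0
  | some x => q x

/-- The law at time `t` of the killed walk started from `q`, conditioned on non-absorption up to
time `t`. -/
noncomputable def conditionedLaw (K : ℕ) [NeZero K] (θ p : ℝ) (q : ZMod K → ℝ) (t : ℝ)
    (x : ZMod K) : ℝ :=
  lawAt (killedGenerator K θ p) (extendByZero q) t (some x) /
    ∑ y : ZMod K, lawAt (killedGenerator K θ p) (extendByZero q) t (some y)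

/-- `q` is a quasi-stationary distribution of the killed walk. -/
def IsQSD (K : ℕ) [NeZero K] (θ p : ℝ) (q : ZMod K → ℝ) : Prop :=
  q ∈ stdSimplex ℝ (ZMod K) ∧ ∀ t : ℝ, 0 ≤ t → conditionedLaw K θ p q t = q

/-! ## The `N`-particle process -/

/-- Configurations of `N` particles on `ℤ/Kℤ`. -/
abbrev Config (K N : ℕ) [NeZero K] : Type :=
  {η : ZMod K → ℕ // ∑ k, η k = N}

instance (K N : ℕ) [NeZero K] : Fintype (Config K N) :=
  Fintype.subtype (Finset.piAntidiag Finset.univ N) (fun η => by simp)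

/-- The configuration `T_{i → j} η = η - e_i + e_j` if `η i > 0` (and `η` otherwise, where the
value is irrelevant). -/
def move {K N : ℕ} [NeZero K] (i j : ZMod K) (η : Config K N) : Config K N :=
  if h : 0 < η.1 i then
    ⟨η.1 - Pi.single i 1 + Pi.single j 1, by
      have h1 : ∑ k, (η.1 - Pi.single i 1 : ZMod K → ℕ) k + ∑ k, (Pi.single i 1 : ZMod K → ℕ) k
          = N := by
        rw [← Finset.sum_add_distrib]
        refine Eq.trans ?_ η.2
        refine Finset.sum_congr rfl fun k _ => ?_
        by_cases hk : k = i
        · subst hk; simp; omega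
        · simp [hk]
      have h2 : ∀ l : ZMod K, ∑ k, (Pi.single l 1 : ZMod K → ℕ) k = 1 := fun l => by simp
      simp only [Pi.add_apply, Finset.sum_add_distrib]
      rw [h2 i] at h1
      rw [h2 j, h1]⟩
  else η

/-- The generator of the `N`-particle Fleming-Viot process. -/
noncomputable def generator (K N : ℕ) [NeZero K] (θ p : ℝ) (f : Config K N → ℝ)
    (η : Config K N) : ℝ :=
  ∑ i : ZMod K, ∑ j : ZMod K, (η.1 i : ℝ) * (f (move i j η) - f η) *
    ((if j = i + 1 then 1 else 0) + θ * (if j = i - 1 then 1 else 0)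
      + p * ((η.1 j : ℝ) / ((N : ℝ) - 1)))

/-- The empirical distribution `m(η)`. -/
noncomputable def empirical {K N : ℕ} [NeZero K] (η : Config K N) : ZMod K → ℝ :=
  fun k => (η.1 k : ℝ) / (N : ℝ)

/-- The `ℓ²` distance between two functions on `ℤ/Kℤ`. -/
noncomputable def l2dist {K : ℕ} [NeZero K] (μ ν : ZMod K → ℝ) : ℝ :=
  Real.sqrt (∑ k, (μ k - ν k) ^ 2)

/-- The expectation of `‖m(η) - q‖₂` when `η` has law `ν`. -/
noncomputable def expectedDist {K N : ℕ} [NeZero K] (ν : Config K N → ℝ) (q : ZMod K → ℝ) : ℝ :=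
  ∑ η : Config K N, ν η * l2dist (empirical η) q

end FlemingViot

namespace FlemingViot

/-! ### Eigenvectors of the semigroup and the forward equation -/

section Exponential

variable {S : Type*} [Fintype S] [DecidableEq S]

/-! Killing at a rate independent of position makes the survival probability `exp (-p t)`, so a QSD
is exactly a probability invariant for the unkilled walk on the cycle. The maximum principle
(`eq_const_of_harmonic`) leaves only the uniform one. For the particles, the invariant law is unique
because every configuration leads to the one with all particles at `0`.

The bound comes from a single test function. Let G be the Green function of the symmetric Laplacian
on the cycle and E(η) = ∑ η(a) η(b) G(a - b). The Laplacian turns G into the identity minus the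
uniform average, so the walk part of the generator applied to E produces ∑ η(i)² - N²/K, which is N²
times the squared distance to uniform, up to a term of order N. As G is even, left and right jumps
contribute equally and the asymmetry enters only through 1 + θ. Resampling contributes -2p E / (N -
1) (`generator_energy`).

Since the generator has mean zero under ν_N, the second moment of the distance is expressed exactly
through the mean of E. Then G ≤ K/8 bounds E (`energy_le`), and Jensen's inequality concludes. The
estimate holds for every N ≥ 2 with no error term. -/

open scoped Matrix.Norms.Operator in
/-- A right eigenvector of a matrix is a right eigenvector of its exponential. -/
theorem exp_mulVec_of_mulVec_eq_smul {A : Matrix S S ℝ} {v : S → ℝ} {c : ℝ}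
    (h : A.mulVec v = c • v) : (NormedSpace.exp A).mulVec v = Real.exp c • v := by
  have hpow : ∀ n : ℕ, (A ^ n).mulVec v = c ^ n • v := by
    intro n
    induction n with
    | zero => simp
    | succ n ih => rw [pow_succ, ← Matrix.mulVec_mulVec, h, Matrix.mulVec_smul, ih, smul_smul,
        pow_succ, mul_comm]
  have h1 : HasSum (fun n : ℕ => ((n.factorial : ℝ)⁻¹ • A ^ n).mulVec v)
      ((NormedSpace.exp A).mulVec v) := by
    have := NormedSpace.exp_series_hasSum_exp' (𝕂 := ℝ) A
    exact this.map (Matrix.mulVec.addMonoidHomLeft v)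
      (Continuous.matrix_mulVec continuous_id continuous_const)
  have h2 : HasSum (fun n : ℕ => ((n.factorial : ℝ)⁻¹ • c ^ n) • v) (Real.exp c • v) := by
    have := NormedSpace.exp_series_hasSum_exp' (𝕂 := ℝ) c
    rw [Real.exp_eq_exp_ℝ]
    exact this.smul_const v
  refine h1.unique ?_
  convert h2 using 2 with n
  rw [Matrix.smul_mulVec, hpow, smul_smul, smul_eq_mul]

/-- A left eigenvector of a matrix is a left eigenvector of its exponential. -/
theorem vecMul_exp_of_vecMul_eq_smul {A : Matrix S S ℝ} {v : S → ℝ} {c : ℝ}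
    (h : Matrix.vecMul v A = c • v) :
    Matrix.vecMul v (NormedSpace.exp A) = Real.exp c • v := by
  rw [← Matrix.mulVec_transpose] at h ⊢
  rw [← Matrix.exp_transpose]
  exact exp_mulVec_of_mulVec_eq_smul h

variable {L : (S → ℝ) → S → ℝ}

theorem lawAt_of_vecMul_eq_smul {μ : S → ℝ} {c : ℝ}
    (h : Matrix.vecMul μ (generatorMatrix L) = c • μ) (t : ℝ) :
    lawAt L μ t = Real.exp (t * c) • μ := by
  refine vecMul_exp_of_vecMul_eq_smul ?_
  rw [Matrix.vecMul_smul, h, smul_smul]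

theorem lawAt_dotProduct_of_mulVec_eq_smul {μ v : S → ℝ} {c : ℝ}
    (h : (generatorMatrix L).mulVec v = c • v) (t : ℝ) :
    lawAt L μ t ⬝ᵥ v = Real.exp (t * c) * (μ ⬝ᵥ v) := by
  rw [lawAt, ← Matrix.dotProduct_mulVec, exp_mulVec_of_mulVec_eq_smul (c := t * c),
    dotProduct_smul, smul_eq_mul]
  rw [Matrix.smul_mulVec, h, smul_smul]

theorem lawAt_add (μ μ' : S → ℝ) (t : ℝ) : lawAt L (μ + μ') t = lawAt L μ t + lawAt L μ' t :=
  Matrix.add_vecMul _ _ _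

open scoped Matrix.Norms.Operator in
/-- The forward equation at time `0`. -/
theorem hasDerivAt_lawAt_zero (μ : S → ℝ) (x : S) :
    HasDerivAt (fun t => lawAt L μ t x) (Matrix.vecMul μ (generatorMatrix L) x) 0 := by
  have h := hasDerivAt_exp_smul_const (𝕂 := ℝ) (generatorMatrix L) (0 : ℝ)
  rw [zero_smul, NormedSpace.exp_zero, one_mul] at h
  have h2 : ∀ i : S, HasDerivAt (fun t : ℝ => NormedSpace.exp (t • generatorMatrix L) i x)
      (generatorMatrix L i x) 0 := fun i => by
    have := ((Matrix.entryLinearMap ℝ ℝ i x).toContinuousLinearMap).hasFDerivAt.comp_hasDerivAt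
      (0 : ℝ) h
    exact this
  simpa [lawAt, Matrix.vecMul, dotProduct] using
    HasDerivAt.fun_sum (u := Finset.univ) fun i _ => (h2 i).const_mul (μ i)

/-- The law is prescribed only for t ≥ 0, so the two right derivatives at `0` are compared. -/
theorem vecMul_apply_eq_of_lawAt {μ : S → ℝ} {x : S} {c : ℝ}
    (h : ∀ t : ℝ, 0 ≤ t → lawAt L μ t x = Real.exp (t * c) * μ x) :
    Matrix.vecMul μ (generatorMatrix L) x = c * μ x := by
  have h1 := (hasDerivAt_lawAt_zero (L := L) μ x).hasDerivWithinAt (s := Set.Ici 0)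
  have h2 : HasDerivAt (fun t : ℝ => Real.exp (t * c) * μ x) (c * μ x) 0 := by
    simpa using (((hasDerivAt_id (0 : ℝ)).mul_const c).exp).mul_const (μ x)
  have h3 := h2.hasDerivWithinAt (s := Set.Ici 0)
  refine (uniqueDiffOn_Ici (0 : ℝ) 0 (by simp)).eq_deriv _ h1 (h3.congr_of_mem ?_ (by simp))
  intro t ht
  exact h t ht

theorem isStationary_iff {ν : S → ℝ} :
    IsStationary L ν ↔ ν ∈ stdSimplex ℝ S ∧ Matrix.vecMul ν (generatorMatrix L) = 0 := by
  refine and_congr_right fun _ => ⟨fun h => ?_, fun h t _ => ?_⟩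
  · funext x
    simpa using vecMul_apply_eq_of_lawAt (c := 0) (fun t ht => by simpa using congrFun (h t ht) x)
  · simpa using lawAt_of_vecMul_eq_smul (c := 0) (by simpa using h) t

end Exponential

/-! ## Invariant vectors of rate matrices -/

section RateMatrix

variable {S : Type*} [Fintype S] [DecidableEq S] {M : Matrix S S ℝ}

/-- The absolute value of a left null vector of a rate matrix is again a left null vector. -/
theorem vecMul_abs_eq_zero (hoff : ∀ x y, x ≠ y → 0 ≤ M x y) (hrow : ∀ x, ∑ y, M x y = 0)
    {v : S → ℝ} (hv : Matrix.vecMul v M = 0) : Matrix.vecMul |v| M = 0 := by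
  -- The entries of |v| M add up to zero because the rows of M do; the triangle inequality makes
  -- each entry nonnegative, so all vanish.
  have hsum : ∑ y, Matrix.vecMul |v| M y = 0 := by
    simp only [Matrix.vecMul, dotProduct]
    rw [Finset.sum_comm]
    simp [← Finset.mul_sum, hrow]
  have hdiag : ∀ y, M y y ≤ 0 := fun y => by
    have h := hrow y
    rw [← Finset.add_sum_erase _ _ (Finset.mem_univ y)] at h
    have : 0 ≤ ∑ z ∈ Finset.univ.erase y, M y z :=
      Finset.sum_nonneg fun z hz => hoff _ _ (Finset.ne_of_mem_erase hz).symm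
    linarith
  have hnn : ∀ y, 0 ≤ Matrix.vecMul |v| M y := fun y => by
    have h := congrFun hv y
    simp only [Matrix.vecMul, dotProduct, Pi.zero_apply, Pi.abs_apply] at h ⊢
    rw [← Finset.add_sum_erase _ _ (Finset.mem_univ y)] at h ⊢
    have h1 : |v y| * M y y = -|v y * M y y| := by
      rw [abs_mul, abs_of_nonpos (hdiag y)]; ring
    have h2 : |∑ x ∈ Finset.univ.erase y, v x * M x y|
        ≤ ∑ x ∈ Finset.univ.erase y, |v x| * M x y := by
      refine (Finset.abs_sum_le_sum_abs _ _).trans (Finset.sum_le_sum fun x hx => ?_)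
      rw [abs_mul, abs_of_nonneg (hoff _ _ (Finset.ne_of_mem_erase hx))]
    have h3 : |v y * M y y| = |∑ x ∈ Finset.univ.erase y, v x * M x y| := by
      rw [eq_neg_of_add_eq_zero_left h, abs_neg]
    linarith
  funext y
  exact (Finset.sum_eq_zero_iff_of_nonneg fun y _ => hnn y).1 hsum y (Finset.mem_univ y)

/-- A nonnegative left null vector of a rate matrix is positive at every state that can be reached
from a state where it is positive. -/
theorem pos_of_vecMul_eq_zero (hoff : ∀ x y, x ≠ y → 0 ≤ M x y) {w : S → ℝ} (hw : 0 ≤ w)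
    (hM : Matrix.vecMul w M = 0) {x y : S}
    (hxy : Relation.ReflTransGen (fun a b => 0 < M a b ∧ a ≠ b) x y) (hx : 0 < w x) : 0 < w y := by
  induction hxy with
  | refl => exact hx
  | @tail a b _ hab ih =>
    refine lt_of_le_of_ne (hw b) fun hb => ?_
    have h := congrFun hM b
    have hnn : ∀ z ∈ Finset.univ, 0 ≤ w z * M z b := fun z _ => by
      by_cases hz : z = b
      · subst hz; simp [← hb]
      · exact mul_nonneg (hw z) (hoff z b hz)
    have := (Finset.sum_eq_zero_iff_of_nonneg hnn).1 h a (Finset.mem_univ a)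
    exact (mul_pos ih hab.1).ne' this

/-- A rate matrix with a state that can be reached from everywhere has exactly one invariant
probability. -/
theorem existsUnique_invariant (hoff : ∀ x y, x ≠ y → 0 ≤ M x y) (hrow : ∀ x, ∑ y, M x y = 0)
    (s : S) (hs : ∀ x, Relation.ReflTransGen (fun a b => 0 < M a b ∧ a ≠ b) x s) :
    ∃! ν : S → ℝ, ν ∈ stdSimplex ℝ S ∧ Matrix.vecMul ν M = 0 := by
  -- Constants lie in the right kernel, so the left kernel is nontrivial too.
  have hdet : M.det = 0 := Matrix.exists_mulVec_eq_zero_iff.1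
    ⟨fun _ => 1, fun h => one_ne_zero (congrFun h s), by
      funext x; simpa [Matrix.mulVec, dotProduct] using hrow x⟩
  obtain ⟨v, hv0, hv⟩ := Matrix.exists_vecMul_eq_zero_iff.2 hdet
  have habs := vecMul_abs_eq_zero hoff hrow hv
  have hpos : 0 < ∑ x, |v x| := by
    obtain ⟨x, hx⟩ := Function.ne_iff.1 hv0
    exact Finset.sum_pos' (fun _ _ => abs_nonneg _) ⟨x, Finset.mem_univ x, abs_pos.2 hx⟩
  have hν : (∑ x, |v x|)⁻¹ • |v| ∈ stdSimplex ℝ S ∧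
      Matrix.vecMul ((∑ x, |v x|)⁻¹ • |v|) M = 0 := by
    refine ⟨⟨fun x => ?_, ?_⟩, ?_⟩
    · simp only [Pi.smul_apply, Pi.abs_apply, smul_eq_mul]; positivity
    · simp only [Pi.smul_apply, Pi.abs_apply, smul_eq_mul]
      rw [← Finset.mul_sum, inv_mul_cancel₀ hpos.ne']
    · rw [Matrix.smul_vecMul, habs, smul_zero]
  have hle : ∀ μ ν : S → ℝ, (μ ∈ stdSimplex ℝ S ∧ Matrix.vecMul μ M = 0) →
      (ν ∈ stdSimplex ℝ S ∧ Matrix.vecMul ν M = 0) → μ ≤ ν := by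
    intro μ ν hμ hν
    by_contra hle
    obtain ⟨x, hx⟩ : ∃ x, ν x < μ x := by simpa [Pi.le_def] using hle
    obtain ⟨y, hy⟩ : ∃ y, μ y < ν y := by
      by_contra! hall
      have := Finset.sum_lt_sum (fun i _ => hall i) ⟨x, Finset.mem_univ x, hx⟩
      rw [hμ.1.2, hν.1.2] at this
      exact lt_irrefl _ this
    have hd : Matrix.vecMul (μ - ν) M = 0 := by rw [Matrix.sub_vecMul, hμ.2, hν.2, sub_zero]
    have hd' := vecMul_abs_eq_zero hoff hrow hd
    -- Twice the positive and twice the negative part of μ - ν are invariant and nonzero, so both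
    -- would be positive at `s`, which is impossible.
    have h1 := pos_of_vecMul_eq_zero (w := |μ - ν| + (μ - ν)) hoff
      (fun z => by
        have := neg_abs_le (μ z - ν z)
        simp only [Pi.zero_apply, Pi.add_apply, Pi.abs_apply, Pi.sub_apply]; linarith)
      (by rw [Matrix.add_vecMul, hd, hd', add_zero]) (hs x)
      (by
        have := abs_nonneg (μ x - ν x)
        simp only [Pi.add_apply, Pi.abs_apply, Pi.sub_apply]; linarith)
    have h2 := pos_of_vecMul_eq_zero (w := |μ - ν| - (μ - ν)) hoff
      (fun z => by
        have := le_abs_self (μ z - ν z)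
        simp only [Pi.zero_apply, Pi.sub_apply, Pi.abs_apply]; linarith)
      (by rw [Matrix.sub_vecMul, hd, hd', sub_zero]) (hs y)
      (by
        have := abs_nonneg (μ y - ν y)
        simp only [Pi.sub_apply, Pi.abs_apply]; linarith)
    simp only [Pi.add_apply, Pi.sub_apply, Pi.abs_apply] at h1 h2
    rcases abs_cases (μ s - ν s) with h | h <;> linarith [h.1]
  exact ⟨_, hν, fun μ hμ => le_antisymm (hle _ _ hμ hν) (hle _ _ hν hμ)⟩

end RateMatrix

/-! ## The quasi-stationary distribution -/

section QSD

variable {K : ℕ} [NeZero K] {θ p : ℝ}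

omit [NeZero K] in
theorem killedGenerator_single (z x : ZMod K) :
    generatorMatrix (killedGenerator K θ p) (some z) (some x) =
      (if z = x - 1 then 1 else 0) + θ * (if z = x + 1 then 1 else 0)
        - (1 + θ + p) * (if z = x then 1 else 0) := by
  have h1 : z + 1 = x ↔ z = x - 1 := eq_sub_iff_add_eq.symm
  have h2 : z - 1 = x ↔ z = x + 1 := sub_eq_iff_eq_add
  simp only [generatorMatrix, Matrix.of_apply, killedGenerator, Pi.single_apply,
    Option.some_inj, h1, h2, reduceCtorEq, if_false]
  ring

theorem vecMul_killedGenerator_some (v : Option (ZMod K) → ℝ) (x : ZMod K) :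
    Matrix.vecMul v (generatorMatrix (killedGenerator K θ p)) (some x) =
      v (some (x - 1)) + θ * v (some (x + 1)) - (1 + θ + p) * v (some x) := by
  have h0 : generatorMatrix (killedGenerator K θ p) none (some x) = 0 := by
    simp [generatorMatrix, killedGenerator]
  simp only [Matrix.vecMul, dotProduct, Fintype.sum_option, h0, killedGenerator_single, mul_sub,
    mul_add, Finset.sum_sub_distrib, Finset.sum_add_distrib]
  simp
  ring

theorem vecMul_killedGenerator_none (v : Option (ZMod K) → ℝ) :
    Matrix.vecMul v (generatorMatrix (killedGenerator K θ p)) none = p * ∑ x, v (some x) := by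
  simp [generatorMatrix, killedGenerator, Matrix.vecMul, dotProduct, Fintype.sum_option,
    Finset.mul_sum, Pi.single_apply, mul_comm]

/-- The survival probability up to time `t` is `exp (-p t)`. -/
theorem sum_lawAt_killedGenerator {q : ZMod K → ℝ} (hq : ∑ x, q x = 1) (t : ℝ) :
    ∑ y : ZMod K, lawAt (killedGenerator K θ p) (extendByZero q) t (some y)
      = Real.exp (t * -p) := by
  -- The indicator of survival is a right eigenvector with eigenvalue -p.
  have h : (generatorMatrix (killedGenerator K θ p)).mulVec
      (fun o => Option.elim o 0 fun _ => 1) = (-p) • (fun o => Option.elim o 0 fun _ => 1) := by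
    funext o
    rcases o with _ | x
    · simp [generatorMatrix, killedGenerator, Matrix.mulVec, dotProduct]
    · simp only [Matrix.mulVec, dotProduct, Fintype.sum_option, killedGenerator_single,
        Option.elim, mul_one, mul_zero, zero_add, Finset.sum_sub_distrib, Finset.sum_add_distrib,
        ← Finset.mul_sum, Pi.smul_apply, smul_eq_mul]
      have e1 : ∀ y : ZMod K, x = y - 1 ↔ x + 1 = y := fun y => eq_sub_iff_add_eq
      have e2 : ∀ y : ZMod K, x = y + 1 ↔ x - 1 = y := fun y => sub_eq_iff_eq_add.symm
      simp [e1, e2]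
  have := lawAt_dotProduct_of_mulVec_eq_smul (μ := extendByZero q) h t
  simpa [dotProduct, Fintype.sum_option, extendByZero, hq] using this

/-- A function on `ℤ/Kℤ` that is harmonic for an asymmetric walk is constant. -/
theorem eq_const_of_harmonic {q : ZMod K → ℝ} (hθ : 0 < θ)
    (h : ∀ x, q (x - 1) + θ * q (x + 1) = (1 + θ) * q x) (x y : ZMod K) : q x = q y := by
  obtain ⟨m, hm⟩ := Finite.exists_max q
  -- Harmonicity at a maximum point forces its left neighbour to be a maximum point; steps to the
  -- left exhaust the cycle.
  suffices hall : ∀ n : ℕ, q (m - n) = q m by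
    have hx : ∀ x, q x = q m := fun x => by
      simpa using hall (m - x).val
    rw [hx x, hx y]
  intro n
  induction n with
  | zero => simp
  | succ n ih =>
    have h1 := h (m - n)
    have h2 := mul_le_mul_of_nonneg_left (hm (m - n + 1)) hθ.le
    have h3 := hm (m - n - 1)
    rw [Nat.cast_succ, ← sub_sub]
    rw [ih] at h1
    linarith

/-- Multiplying the conditioned law by the survival probability gives exp(-pt) q; differentiating at
`0`, the killing terms cancel and q is harmonic. -/
theorem isQSD_iff (hθ : 0 < θ) (q : ZMod K → ℝ) :
    IsQSD K θ p q ↔ q = fun _ => 1 / (K : ℝ) := by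
  have hK : (K : ℝ) ≠ 0 := Nat.cast_ne_zero.2 (NeZero.ne K)
  constructor
  · rintro ⟨hq, h⟩
    have hlaw : ∀ x : ZMod K, ∀ t : ℝ, 0 ≤ t →
        lawAt (killedGenerator K θ p) (extendByZero q) t (some x) =
          Real.exp (t * -p) * extendByZero q (some x) := by
      intro x t ht
      have := congrFun (h t ht) x
      rw [conditionedLaw, sum_lawAt_killedGenerator hq.2, div_eq_iff (Real.exp_pos _).ne'] at this
      rw [this, mul_comm]; rfl
    have hharm : ∀ x, q (x - 1) + θ * q (x + 1) = (1 + θ) * q x := by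
      intro x
      have := vecMul_apply_eq_of_lawAt (hlaw x)
      rw [vecMul_killedGenerator_some] at this
      simp only [extendByZero] at this
      linarith
    have hc := eq_const_of_harmonic hθ hharm
    funext x
    have hs := hq.2
    rw [Finset.sum_congr rfl fun y _ => hc y x] at hs
    rw [eq_div_iff hK]
    simpa [mul_comm] using hs
  · rintro rfl
    have hsum : ∑ _x : ZMod K, (1 / (K : ℝ)) = 1 := by simp [hK]
    refine ⟨⟨fun _ => by positivity, hsum⟩, fun t _ => ?_⟩
    funext x
    rw [conditionedLaw, sum_lawAt_killedGenerator hsum, div_eq_iff (Real.exp_pos _).ne']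
    -- The uniform law extended by zero is not a left eigenvector, but it is the sum of two: one of
    -- total mass zero, with value -1 at ∂ and eigenvalue -p, and the absorbed point mass, with
    -- eigenvalue 0.
    have h1 : Matrix.vecMul (fun o : Option (ZMod K) => Option.elim o (-1) fun _ => 1 / (K : ℝ))
        (generatorMatrix (killedGenerator K θ p)) =
        (-p) • fun o : Option (ZMod K) => Option.elim o (-1) fun _ => 1 / (K : ℝ) := by
      funext o
      rcases o with _ | x
      · rw [vecMul_killedGenerator_none]; simp [hK]
      · rw [vecMul_killedGenerator_some]
        simp only [Option.elim, Pi.smul_apply, smul_eq_mul]; ring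
    have h2 : Matrix.vecMul (fun o : Option (ZMod K) => Option.elim o 1 fun _ => 0)
        (generatorMatrix (killedGenerator K θ p)) =
        (0 : ℝ) • fun o : Option (ZMod K) => Option.elim o 1 fun _ => 0 := by
      funext o
      rcases o with _ | x
      · rw [vecMul_killedGenerator_none]; simp
      · rw [vecMul_killedGenerator_some]; simp
    have h3 : (extendByZero fun _ : ZMod K => 1 / (K : ℝ)) =
        (fun o : Option (ZMod K) => Option.elim o (-1) fun _ => 1 / (K : ℝ)) +
          fun o : Option (ZMod K) => Option.elim o 1 fun _ => 0 := by
      funext o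
      rcases o with _ | x <;> simp [extendByZero]
    rw [h3, lawAt_add, lawAt_of_vecMul_eq_smul h1, lawAt_of_vecMul_eq_smul h2]
    simp [mul_comm]

end QSD

/-! ## The generator of the particle process -/

section Particles

variable {K N : ℕ} [NeZero K] {θ p : ℝ}

/-- The rate at which one particle at `i` jumps to `j` in the configuration `η`. -/
noncomputable def jumpRate (θ p : ℝ) (η : Config K N) (i j : ZMod K) : ℝ :=
  (if j = i + 1 then 1 else 0) + θ * (if j = i - 1 then 1 else 0)
    + p * ((η.1 j : ℝ) / ((N : ℝ) - 1))

theorem generator_apply (f : Config K N → ℝ) (η : Config K N) :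
    generator K N θ p f η =
      ∑ i : ZMod K, ∑ j : ZMod K, (η.1 i : ℝ) * (f (move i j η) - f η) * jumpRate θ p η i j :=
  rfl

theorem jumpRate_nonneg (hN : 2 ≤ N) (hθ : 0 < θ) (hp : 0 < p) (η : Config K N) (i j : ZMod K) :
    0 ≤ jumpRate θ p η i j := by
  have : (0 : ℝ) ≤ (N : ℝ) - 1 := by
    have : (2 : ℝ) ≤ N := by exact_mod_cast hN
    linarith
  unfold jumpRate
  split_ifs <;> positivity

theorem generator_eq_mulVec (f : Config K N → ℝ) :
    generator K N θ p f = (generatorMatrix (generator K N θ p)).mulVec f := by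
  funext η
  simp only [Matrix.mulVec, dotProduct, generatorMatrix, Matrix.of_apply, generator_apply,
    Finset.sum_mul]
  symm
  rw [Finset.sum_comm]
  refine Finset.sum_congr rfl fun i _ => ?_
  rw [Finset.sum_comm]
  refine Finset.sum_congr rfl fun j _ => ?_
  simp [Pi.single_apply, mul_assoc, sub_mul, mul_sub, Finset.sum_sub_distrib,
    mul_comm (jumpRate θ p η i j)]

theorem generatorMatrix_row_sum (η : Config K N) :
    ∑ ζ, generatorMatrix (generator K N θ p) η ζ = 0 := by
  have h := congrFun (generator_eq_mulVec (θ := θ) (p := p) (fun _ : Config K N => (1 : ℝ))) η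
  simp only [Matrix.mulVec, dotProduct, mul_one] at h
  rw [← h, generator_apply]
  simp

theorem generatorMatrix_summand_nonneg (hN : 2 ≤ N) (hθ : 0 < θ) (hp : 0 < p) {η ζ : Config K N}
    (h : η ≠ ζ) (i j : ZMod K) :
    0 ≤ (η.1 i : ℝ) * ((Pi.single ζ (1 : ℝ) : Config K N → ℝ) (move i j η)
      - (Pi.single ζ (1 : ℝ) : Config K N → ℝ) η) * jumpRate θ p η i j := by
  refine mul_nonneg (mul_nonneg (Nat.cast_nonneg _) ?_) (jumpRate_nonneg hN hθ hp η i j)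
  rw [Pi.single_eq_of_ne h, sub_zero, Pi.single_apply]
  split_ifs <;> norm_num

theorem generatorMatrix_nonneg (hN : 2 ≤ N) (hθ : 0 < θ) (hp : 0 < p) (η ζ : Config K N)
    (h : η ≠ ζ) : 0 ≤ generatorMatrix (generator K N θ p) η ζ :=
  Finset.sum_nonneg fun i _ => Finset.sum_nonneg fun j _ =>
    generatorMatrix_summand_nonneg hN hθ hp h i j

theorem move_apply {η : Config K N} {i : ZMod K} (hi : 0 < η.1 i) (j k : ZMod K) :
    ((move i j η).1 k : ℝ) = η.1 k + ((if k = j then 1 else 0) - (if k = i then 1 else 0)) := by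
  simp only [move, hi, dif_pos, Pi.add_apply, Pi.sub_apply, Pi.single_apply]
  by_cases h : k = i
  · subst h
    simp only [if_true]
    rw [Nat.cast_add, Nat.cast_sub (by omega)]
    split_ifs <;> push_cast <;> ring
  · simp [h]

theorem sum_move {η : Config K N} {i : ZMod K} (hi : 0 < η.1 i) (j : ZMod K) (g : ZMod K → ℝ) :
    ∑ k, ((move i j η).1 k : ℝ) * g k = ∑ k, (η.1 k : ℝ) * g k + g j - g i := by
  simp only [move_apply hi, add_mul, sub_mul, Finset.sum_add_distrib, Finset.sum_sub_distrib]
  simp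
  ring

theorem generatorMatrix_move_pos (hK : 3 ≤ K) (hN : 2 ≤ N) (hθ : 0 < θ) (hp : 0 < p)
    {η : Config K N} {i : ZMod K} (hi : 0 < η.1 i) :
    0 < generatorMatrix (generator K N θ p) η (move i (i + 1) η) ∧ η ≠ move i (i + 1) η := by
  have : Fact (1 < K) := ⟨by omega⟩
  have hne : η ≠ move i (i + 1) η := by
    intro h
    have := move_apply hi (i + 1) i
    rw [← h] at this
    simp at this
  refine ⟨?_, hne⟩
  have hnn := generatorMatrix_summand_nonneg hN hθ hp hne
  refine Finset.sum_pos' (fun k _ => Finset.sum_nonneg fun j _ => hnn k j)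
    ⟨i, Finset.mem_univ _, Finset.sum_pos' (fun j _ => hnn i j) ⟨i + 1, Finset.mem_univ _, ?_⟩⟩
  rw [Pi.single_eq_same, Pi.single_eq_of_ne hne]
  have h1 : (0 : ℝ) ≤ (N : ℝ) - 1 := by
    have : (2 : ℝ) ≤ N := by exact_mod_cast hN
    linarith
  have h2 : (0 : ℝ) < η.1 i := by exact_mod_cast hi
  simp only [if_true]
  split_ifs <;> positivity

/-- The configuration with all particles at `0`. -/
def concentrated (K N : ℕ) [NeZero K] : Config K N :=
  ⟨Pi.single 0 N, by simp⟩

theorem eq_concentrated {η : Config K N} (h : ∀ i, i ≠ 0 → η.1 i = 0) : η = concentrated K N := by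
  have hs := η.2
  rw [Finset.sum_eq_single 0 (fun i _ hi => h i hi) (by simp)] at hs
  refine Subtype.ext (funext fun i => ?_)
  by_cases hi : i = 0
  · subst hi; simpa [concentrated] using hs
  · simp [concentrated, hi, h i hi]

/-- Moving a particle from a nonzero site one step to the right lowers by one the total number of
right steps needed to bring all particles to `0`. -/
theorem reachable_concentrated (hK : 3 ≤ K) (hN : 2 ≤ N) (hθ : 0 < θ) (hp : 0 < p)
    (η : Config K N) :
    Relation.ReflTransGen
      (fun a b => 0 < generatorMatrix (generator K N θ p) a b ∧ a ≠ b) η (concentrated K N) := by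
  have : Fact (1 < K) := ⟨by omega⟩
  induction hn : ∑ k, η.1 k * (-k).val using Nat.strong_induction_on generalizing η with
  | _ n ih =>
  by_cases h : ∀ i, i ≠ 0 → η.1 i = 0
  · rw [eq_concentrated h]
  · push Not at h
    obtain ⟨i, hi0, hi⟩ := h
    have hi' : 0 < η.1 i := Nat.pos_of_ne_zero hi
    refine .head (generatorMatrix_move_pos hK hN hθ hp hi') (ih _ ?_ _ rfl)
    have hval : (-(i + 1)).val + 1 = (-i).val := by
      have hne : (-i).val ≠ 0 := by simpa [ZMod.val_eq_zero] using hi0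
      rw [neg_add, ← sub_eq_add_neg, ZMod.val_sub (by rw [ZMod.val_one]; omega), ZMod.val_one]
      omega
    have hmove := sum_move hi' (i + 1) fun k => ((-k).val : ℝ)
    have hval' : (((-(i + 1)).val : ℕ) : ℝ) + 1 = ((-i).val : ℕ) := by exact_mod_cast hval
    have hn' : (∑ k, (η.1 k : ℝ) * ((-k).val : ℝ)) = n := by rw [← hn]; push_cast; rfl
    have : ((∑ k, (move i (i + 1) η).1 k * (-k).val : ℕ) : ℝ) < n := by
      push_cast
      linarith
    exact_mod_cast this

theorem existsUnique_isStationary (hK : 3 ≤ K) (hN : 2 ≤ N) (hθ : 0 < θ) (hp : 0 < p) :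
    ∃! ν : Config K N → ℝ, IsStationary (generator K N θ p) ν := by
  simp only [isStationary_iff]
  exact existsUnique_invariant (generatorMatrix_nonneg hN hθ hp) generatorMatrix_row_sum
    (concentrated K N) (reachable_concentrated hK hN hθ hp)

/-- The generator has mean zero under a stationary distribution. -/
theorem sum_mul_generator_eq_zero {ν : Config K N → ℝ}
    (hν : IsStationary (generator K N θ p) ν) (f : Config K N → ℝ) :
    ∑ η, ν η * generator K N θ p f η = 0 := by
  have h : ν ⬝ᵥ generator K N θ p f = 0 := by
    rw [generator_eq_mulVec, Matrix.dotProduct_mulVec, (isStationary_iff.1 hν).2, zero_dotProduct]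
  exact h

end Particles

/-! ## The Green function of the cycle -/

section Green

variable {K : ℕ} [NeZero K]

/-- The function `k (K - k) / (2K)` on the cycle, a Green function of its Laplacian. -/
noncomputable def green (K : ℕ) (k : ZMod K) : ℝ :=
  (k.val : ℝ) * ((K : ℝ) - k.val) / (2 * K)

omit [NeZero K] in
theorem green_zero : green K 0 = 0 := by simp [green]

theorem green_neg (k : ZMod K) : green K (-k) = green K k := by
  by_cases h : k = 0
  · rw [h, neg_zero]
  · have hk := ZMod.neg_val k
    rw [if_neg h] at hk
    rw [green, green, hk, Nat.cast_sub (ZMod.val_le k)]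
    ring

theorem green_sub_comm (a b : ZMod K) : green K (a - b) = green K (b - a) := by
  rw [← green_neg, neg_sub]

theorem green_le (k : ZMod K) : green K k ≤ K / 8 := by
  have hK : (0 : ℝ) < K := Nat.cast_pos.2 (NeZero.pos K)
  rw [green, div_le_iff₀ (by positivity)]
  nlinarith [sq_nonneg ((K : ℝ) - 2 * k.val)]

theorem green_add_one (hK : 3 ≤ K) (k : ZMod K) :
    green K (k + 1) = ((k.val : ℝ) + 1) * ((K : ℝ) - (k.val + 1)) / (2 * K) := by
  have : Fact (1 < K) := ⟨by omega⟩
  have hk := ZMod.val_lt k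
  rcases lt_or_ge (k.val + 1) K with h | h
  · rw [green, ZMod.val_add_of_lt (by rwa [ZMod.val_one]), ZMod.val_one]
    push_cast
    ring
  -- At the wraparound the quadratic formula still holds, because it vanishes at K as well as at 0.
  · have h1 : k.val + 1 = K := by omega
    have h2 : k + 1 = 0 := by
      rw [← ZMod.natCast_zmod_val k, ← Nat.cast_succ, Nat.succ_eq_add_one, h1,
        ZMod.natCast_self]
    have h3 : (k.val : ℝ) + 1 = K := by exact_mod_cast h1
    rw [h2, h3, green_zero, sub_self, mul_zero, zero_div]

/-- The discrete Poisson equation for the Green function. -/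
theorem green_laplacian (hK : 3 ≤ K) (k : ZMod K) :
    green K (k + 1) + green K (k - 1) - 2 * green K k = (if k = 0 then 1 else 0) - 1 / K := by
  have hK0 : (K : ℝ) ≠ 0 := Nat.cast_ne_zero.2 (NeZero.ne K)
  -- Reflection reduces the left neighbour to the successor formula; the source at 0 appears because
  -- `(-0).val` is 0 rather than K.
  have h1 : green K (k - 1) = green K (-k + 1) := by
    rw [← green_neg, neg_sub', sub_neg_eq_add]
  rw [h1, green_add_one hK, green_add_one hK, ZMod.neg_val, green]
  split_ifs with h
  · subst h
    simp only [ZMod.val_zero, Nat.cast_zero]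
    field_simp
    ring
  · rw [Nat.cast_sub (ZMod.val_le k)]
    field_simp
    ring

theorem green_one (hK : 3 ≤ K) : 2 * green K 1 = 1 - 1 / K := by
  have h := green_laplacian hK (0 : ZMod K)
  rw [zero_add, zero_sub, green_neg, green_zero, if_pos rfl] at h
  linarith

end Green

/-! ## The energy of a configuration -/

section Energy

variable {K N : ℕ} [NeZero K] {θ p : ℝ}

/-- The potential at `j` created by the particles of `η`. -/
noncomputable def potential (η : Config K N) (j : ZMod K) : ℝ :=
  ∑ b, (η.1 b : ℝ) * green K (b - j)

/-- The energy of `η` for the Green function of the cycle. -/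
noncomputable def energy (η : Config K N) : ℝ :=
  ∑ a, (η.1 a : ℝ) * potential η a

theorem sum_config (η : Config K N) : ∑ k, (η.1 k : ℝ) = N := by
  exact_mod_cast η.2

theorem potential_move {η : Config K N} {i : ZMod K} (hi : 0 < η.1 i) (j k : ZMod K) :
    potential (move i j η) k = potential η k + green K (j - k) - green K (i - k) :=
  sum_move hi j fun b => green K (b - k)

/-- Expansion of a quadratic form along d = e_j - e_i: the linear term is twice the potential
difference, and the self-energy of d is -2 G(i - j) since G(0) = 0. -/
theorem energy_move {η : Config K N} {i : ZMod K} (hi : 0 < η.1 i) (j : ZMod K) :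
    energy (move i j η) - energy η =
      2 * (potential η j - potential η i) - 2 * green K (i - j) := by
  have h : ∀ l, ∑ a, (η.1 a : ℝ) * green K (l - a) = potential η l := fun l =>
    Finset.sum_congr rfl fun a _ => by rw [green_sub_comm]
  rw [energy, sum_move hi]
  simp only [potential_move hi, mul_add, mul_sub, Finset.sum_add_distrib, Finset.sum_sub_distrib,
    h, sub_self, green_zero]
  rw [green_sub_comm j i, energy]
  ring

/-- Exchanging the two particles of a pair and using that G is even swaps the two shifts. This is
why the drift direction does not matter. -/
theorem sum_mul_potential_add_one (η : Config K N) :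
    ∑ i, (η.1 i : ℝ) * potential η (i + 1) = ∑ i, (η.1 i : ℝ) * potential η (i - 1) := by
  simp only [potential, Finset.mul_sum]
  rw [Finset.sum_comm]
  refine Finset.sum_congr rfl fun a _ => Finset.sum_congr rfl fun b _ => ?_
  rw [green_sub_comm, show b + 1 - a = b - (a - 1) by ring]
  ring

theorem potential_laplacian (hK : 3 ≤ K) (η : Config K N) (i : ZMod K) :
    potential η (i + 1) + potential η (i - 1) - 2 * potential η i = η.1 i - N / K := by
  have h : ∀ b, (η.1 b : ℝ) * green K (b - (i + 1)) + (η.1 b : ℝ) * green K (b - (i - 1))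
      - 2 * ((η.1 b : ℝ) * green K (b - i)) =
      (η.1 b : ℝ) * (if b = i then 1 else 0) - (η.1 b : ℝ) * (1 / K) := fun b => by
    have := green_laplacian hK (b - i)
    rw [show b - (i + 1) = b - i - 1 by ring, show b - (i - 1) = b - i + 1 by ring]
    simp only [sub_eq_zero] at this
    linear_combination (η.1 b : ℝ) * this
  simp only [potential, Finset.mul_sum]
  rw [← Finset.sum_add_distrib, ← Finset.sum_sub_distrib, Finset.sum_congr rfl fun b _ => h b,
    Finset.sum_sub_distrib, ← Finset.sum_mul, sum_config]
  simp [div_eq_mul_inv]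

theorem sum_mul_potential_sub (hK : 3 ≤ K) (η : Config K N) :
    2 * (∑ i, (η.1 i : ℝ) * (potential η (i + 1) - potential η i)) =
      ∑ i, (η.1 i : ℝ) ^ 2 - (N : ℝ) ^ 2 / K := by
  have h : ∑ i, (η.1 i : ℝ) * (potential η (i + 1) + potential η (i - 1) - 2 * potential η i) =
      ∑ i, (η.1 i : ℝ) ^ 2 - (N : ℝ) ^ 2 / K := by
    simp only [potential_laplacian hK, mul_sub, Finset.sum_sub_distrib, ← Finset.sum_mul,
      sum_config, sq, mul_div_assoc]
  have h' := sum_mul_potential_add_one η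
  simp only [mul_sub, mul_add, Finset.sum_sub_distrib, Finset.sum_add_distrib,
    mul_left_comm _ (2 : ℝ), ← Finset.mul_sum] at h ⊢
  linarith

/-- The action of the generator on the energy. -/
theorem generator_energy (hK : 3 ≤ K) (η : Config K N) :
    generator K N θ p energy η =
      (1 + θ) * (∑ i, (η.1 i : ℝ) ^ 2 - (N : ℝ) ^ 2 / K - N * (1 - 1 / K))
        - 2 * p / ((N : ℝ) - 1) * energy η := by
  -- At an empty site `move` takes its default value, and the factor η(i) removes the term.
  have hdiff : ∀ i j, (η.1 i : ℝ) * (energy (move i j η) - energy η) =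
      (η.1 i : ℝ) * (2 * (potential η j - potential η i) - 2 * green K (i - j)) := by
    intro i j
    rcases Nat.eq_zero_or_pos (η.1 i) with h | h
    · simp [h]
    · rw [energy_move h]
  have hterm : ∀ i, ∑ j, (η.1 i : ℝ) * (energy (move i j η) - energy η) * jumpRate θ p η i j =
      (η.1 i : ℝ) * (2 * (potential η (i + 1) - potential η i) - 2 * green K 1)
        + θ * ((η.1 i : ℝ) * (2 * (potential η (i - 1) - potential η i) - 2 * green K 1))
        + p / ((N : ℝ) - 1) * (2 * ((η.1 i : ℝ) * ∑ j, (η.1 j : ℝ) * potential η j)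
          - 2 * N * ((η.1 i : ℝ) * potential η i) - 2 * ((η.1 i : ℝ) * potential η i)) := by
    intro i
    have h1 : ∑ j, (η.1 i : ℝ) * (2 * (potential η j - potential η i) - 2 * green K (i - j)) *
        (if j = i + 1 then 1 else 0) =
        (η.1 i : ℝ) * (2 * (potential η (i + 1) - potential η i) - 2 * green K 1) := by
      have : i - (i + 1) = -1 := by ring
      simp [this, green_neg]
    have h2 : ∑ j, (η.1 i : ℝ) * (2 * (potential η j - potential η i) - 2 * green K (i - j)) *
        (if j = i - 1 then 1 else 0) =
        (η.1 i : ℝ) * (2 * (potential η (i - 1) - potential η i) - 2 * green K 1) := by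
      simp
    -- Resampling: after summation over i the first two terms are 2N E and -2N E, so only -2E
    -- survives.
    have h3 : ∑ j, (η.1 i : ℝ) * (2 * (potential η j - potential η i) - 2 * green K (i - j)) *
        (η.1 j : ℝ) = 2 * ((η.1 i : ℝ) * ∑ j, (η.1 j : ℝ) * potential η j)
          - 2 * N * ((η.1 i : ℝ) * potential η i) - 2 * ((η.1 i : ℝ) * potential η i) := by
      have e : potential η i = ∑ j, (η.1 j : ℝ) * green K (i - j) :=
        Finset.sum_congr rfl fun j _ => by rw [green_sub_comm]
      have e' : ∀ j, (η.1 i : ℝ) * (2 * (potential η j - potential η i) - 2 * green K (i - j)) *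
          (η.1 j : ℝ) = 2 * (η.1 i : ℝ) * ((η.1 j : ℝ) * potential η j)
            - (η.1 j : ℝ) * (2 * (η.1 i : ℝ) * potential η i)
            - 2 * (η.1 i : ℝ) * ((η.1 j : ℝ) * green K (i - j)) := fun j => by ring
      rw [Finset.sum_congr rfl fun j _ => e' j, Finset.sum_sub_distrib, Finset.sum_sub_distrib,
        ← Finset.mul_sum, ← Finset.mul_sum, ← Finset.sum_mul, sum_config, ← e]
      ring
    rw [← h1, ← h2, ← h3, Finset.mul_sum, Finset.mul_sum, ← Finset.sum_add_distrib,
      ← Finset.sum_add_distrib]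
    refine Finset.sum_congr rfl fun j _ => ?_
    rw [hdiff, jumpRate]
    ring
  have hright := sum_mul_potential_sub hK η
  have hleft := sum_mul_potential_add_one η
  have hone := green_one hK
  have hN := sum_config η
  rw [generator_apply, Finset.sum_congr rfl fun i _ => hterm i]
  have hE : ∑ i, (η.1 i : ℝ) * potential η i = energy η := rfl
  simp only [mul_sub, Finset.sum_sub_distrib, Finset.sum_add_distrib, mul_left_comm _ (2 : ℝ),
    ← Finset.mul_sum, ← Finset.sum_mul, hE, hN, ← hleft] at hright ⊢
  linear_combination (1 + θ) * hright - (1 + θ) * N * hone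

theorem sum_sq_ge (η : Config K N) : (N : ℝ) ≤ ∑ i, (η.1 i : ℝ) ^ 2 := by
  have h : N ≤ ∑ i, η.1 i ^ 2 := by
    conv_lhs => rw [← η.2]
    exact Finset.sum_le_sum fun i _ => Nat.le_self_pow two_ne_zero _
  exact_mod_cast h

/-- Only pairs at distinct sites carry energy, and integrality gives ∑ η(i)² ≥ N, so there are at
most N(N - 1) ordered pairs. The factor N - 1 later cancels that of the resampling rate. -/
theorem energy_le (η : Config K N) : energy η ≤ K / 8 * (N * ((N : ℝ) - 1)) := by
  have h : ∀ a b, (η.1 a : ℝ) * ((η.1 b : ℝ) * green K (b - a)) ≤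
      (η.1 a : ℝ) * ((η.1 b : ℝ) * (K / 8 * (1 - if b = a then 1 else 0))) := by
    intro a b
    gcongr
    split_ifs with hab
    · rw [hab, sub_self, green_zero, sub_self, mul_zero]
    · simpa using green_le (b - a)
  have hs : ∑ a, ∑ b, (η.1 a : ℝ) * ((η.1 b : ℝ) * (K / 8 * (1 - if b = a then 1 else 0))) =
      K / 8 * ((N : ℝ) ^ 2 - ∑ i, (η.1 i : ℝ) ^ 2) := by
    have : ∀ a, ∑ b, (η.1 a : ℝ) * ((η.1 b : ℝ) * (K / 8 * (1 - if b = a then 1 else 0))) =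
        K / 8 * ((η.1 a : ℝ) * N - (η.1 a : ℝ) ^ 2) := by
      intro a
      rw [← Finset.mul_sum]
      simp only [mul_sub, mul_one, Finset.sum_sub_distrib, ← Finset.sum_mul, sum_config]
      simp
      ring
    rw [Finset.sum_congr rfl fun a _ => this a, ← Finset.mul_sum, Finset.sum_sub_distrib,
      ← Finset.sum_mul, sum_config, sq]
  have hK : (0 : ℝ) ≤ K / 8 := by positivity
  calc energy η = ∑ a, ∑ b, (η.1 a : ℝ) * ((η.1 b : ℝ) * green K (b - a)) := by
        simp only [energy, potential, Finset.mul_sum]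
    _ ≤ _ := Finset.sum_le_sum fun a _ => Finset.sum_le_sum fun b _ => h a b
    _ = _ := hs
    _ ≤ _ := mul_le_mul_of_nonneg_left (by nlinarith [sum_sq_ge η]) hK

/-! ## Distance to the uniform distribution -/

theorem l2dist_sq (hN : 2 ≤ N) (η : Config K N) :
    l2dist (empirical η) (fun _ => 1 / (K : ℝ)) ^ 2 =
      (∑ i, (η.1 i : ℝ) ^ 2) / (N : ℝ) ^ 2 - 1 / K := by
  have hK : (K : ℝ) ≠ 0 := Nat.cast_ne_zero.2 (NeZero.ne K)
  have hN0 : (N : ℝ) ≠ 0 := Nat.cast_ne_zero.2 (by omega)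
  rw [l2dist, Real.sq_sqrt (Finset.sum_nonneg fun _ _ => sq_nonneg _)]
  have : ∀ k, (empirical η k - 1 / (K : ℝ)) ^ 2 =
      (η.1 k : ℝ) ^ 2 * (1 / (N : ℝ) ^ 2) - (η.1 k : ℝ) * (2 / (N * K)) + 1 / (K : ℝ) ^ 2 := by
    intro k
    rw [empirical]
    field_simp
    ring
  rw [Finset.sum_congr rfl fun k _ => this k, Finset.sum_add_distrib, Finset.sum_sub_distrib,
    ← Finset.sum_mul, ← Finset.sum_mul, sum_config]
  simp only [Finset.sum_const, Finset.card_univ, ZMod.card, nsmul_eq_mul]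
  field_simp
  ring

/-- The second moment of the distance between the empirical distribution and the uniform one. -/
theorem sum_mul_l2dist_sq_le (hK : 3 ≤ K) (hN : 2 ≤ N) (hθ : 0 < θ) (hp : 0 < p)
    {ν : Config K N → ℝ} (hν : IsStationary (generator K N θ p) ν) :
    ∑ η, ν η * l2dist (empirical η) (fun _ => 1 / (K : ℝ)) ^ 2 ≤
      ((K : ℝ) - 1) / N * (1 + p * ((K : ℝ) + 1) / (6 * (1 + θ))) := by
  have hKr : (3 : ℝ) ≤ K := by exact_mod_cast hK
  have hNr : (2 : ℝ) ≤ N := by exact_mod_cast hN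
  have hN1 : (0 : ℝ) < (N : ℝ) - 1 := by linarith
  have hK0 : (0 : ℝ) < K := by linarith
  have hN0 : (0 : ℝ) < N := by linarith
  set s : ℝ := ∑ η, ν η * ∑ i, (η.1 i : ℝ) ^ 2 with hs
  set e : ℝ := ∑ η, ν η * energy η with he
  have hmass := hν.1.2
  have hcomb : ∀ a b c : ℝ, ∑ η, ν η * (a * (∑ i, (η.1 i : ℝ) ^ 2) + b * energy η + c) =
      a * s + b * e + c := by
    intro a b c
    simp only [mul_add, Finset.sum_add_distrib, mul_left_comm (ν _), ← Finset.mul_sum,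
      ← Finset.sum_mul, hmass, ← hs, ← he, one_mul]
  have hbal : (1 + θ) * (s - (N : ℝ) ^ 2 / K - N * (1 - 1 / K)) = 2 * p / ((N : ℝ) - 1) * e := by
    have h := sum_mul_generator_eq_zero hν energy
    have h2 := hcomb (1 + θ) (-(2 * p / ((N : ℝ) - 1)))
      (-((1 + θ) * ((N : ℝ) ^ 2 / K + N * (1 - 1 / K))))
    have h3 : ∑ η, ν η * generator K N θ p energy η =
        ∑ η, ν η * ((1 + θ) * (∑ i, (η.1 i : ℝ) ^ 2) + (-(2 * p / ((N : ℝ) - 1))) * energy η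
          + -((1 + θ) * ((N : ℝ) ^ 2 / K + N * (1 - 1 / K)))) :=
      Finset.sum_congr rfl fun η _ => by rw [generator_energy hK]; ring
    rw [← h3, h] at h2
    linear_combination -h2
  have hele : e ≤ K / 8 * (N * ((N : ℝ) - 1)) := by
    calc e ≤ ∑ η, ν η * (K / 8 * (N * ((N : ℝ) - 1))) :=
          Finset.sum_le_sum fun η _ => mul_le_mul_of_nonneg_left (energy_le η) (hν.1.1 η)
      _ = _ := by rw [← Finset.sum_mul, hmass, one_mul]
  have hdist : ∑ η, ν η * l2dist (empirical η) (fun _ => 1 / (K : ℝ)) ^ 2 =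
      s / (N : ℝ) ^ 2 - 1 / K := by
    have h := hcomb (1 / (N : ℝ) ^ 2) 0 (-(1 / K))
    rw [show s / (N : ℝ) ^ 2 - 1 / K = 1 / (N : ℝ) ^ 2 * s + 0 * e + -(1 / K) by ring, ← h]
    exact Finset.sum_congr rfl fun η _ => by rw [l2dist_sq hN]; ring
  have hs_le : s - (N : ℝ) ^ 2 / K ≤ N * (1 - 1 / K) + p * K * N / (4 * (1 + θ)) := by
    have h1 : 2 * p / ((N : ℝ) - 1) * e ≤ p * K * N / 4 := by
      calc 2 * p / ((N : ℝ) - 1) * e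
          ≤ 2 * p / ((N : ℝ) - 1) * (K / 8 * (N * ((N : ℝ) - 1))) := by gcongr
        _ = p * K * N / 4 := by field_simp; ring
    have h2 : s - (N : ℝ) ^ 2 / K - N * (1 - 1 / K) ≤ p * K * N / 4 / (1 + θ) := by
      rw [le_div_iff₀ (by positivity)]
      linarith
    rw [div_div] at h2
    linarith
  -- The target has room to spare: 1 - 1/K is replaced by K - 1, and the crude K/4 coming from G ≤
  -- K/8 is at most (K² - 1)/6 for K ≥ 3.
  have hinv : 1 - 1 / (K : ℝ) ≤ K - 1 := by
    have : (0 : ℝ) < 1 / K := by positivity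
    linarith
  have hpoly : p * K / (4 * (1 + θ)) ≤ ((K : ℝ) - 1) * (p * ((K : ℝ) + 1) / (6 * (1 + θ))) := by
    rw [← mul_div_assoc, div_le_div_iff₀ (by positivity) (by positivity)]
    have hq : 6 * (K : ℝ) ≤ 4 * (((K : ℝ) - 1) * (K + 1)) := by nlinarith
    have := mul_le_mul_of_nonneg_left hq (mul_pos hp (by positivity : 0 < 1 + θ)).le
    linarith
  rw [hdist]
  calc s / (N : ℝ) ^ 2 - 1 / K = (s - (N : ℝ) ^ 2 / K) / (N : ℝ) ^ 2 := by field_simp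
    _ ≤ (N * (1 - 1 / K) + p * K * N / (4 * (1 + θ))) / (N : ℝ) ^ 2 := by gcongr
    _ = (1 - 1 / K + p * K / (4 * (1 + θ))) / N := by field_simp
    _ ≤ ((K - 1) + ((K : ℝ) - 1) * (p * ((K : ℝ) + 1) / (6 * (1 + θ)))) / N := by gcongr
    _ = _ := by ring

theorem expectedDist_le (hK : 3 ≤ K) (hN : 2 ≤ N) (hθ : 0 < θ) (hp : 0 < p)
    {ν : Config K N → ℝ} (hν : IsStationary (generator K N θ p) ν) :
    expectedDist ν (fun _ => 1 / (K : ℝ)) ≤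
      Real.sqrt (((K : ℝ) - 1) / N) * Real.sqrt (1 + p * ((K : ℝ) + 1) / (6 * (1 + θ))) := by
  have hKr : (3 : ℝ) ≤ K := by exact_mod_cast hK
  rw [← Real.sqrt_mul (div_nonneg (by linarith) (Nat.cast_nonneg N))]
  refine Real.le_sqrt_of_sq_le (le_trans ?_ (sum_mul_l2dist_sq_le hK hN hθ hp hν))
  exact Real.pow_arith_mean_le_arith_mean_pow _ _ _ (fun η _ => hν.1.1 η) hν.1.2
    (fun η _ => Real.sqrt_nonneg _) 2

end Energy
end FlemingViot
-- Assembly of the four claims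
theorem mainTheorem7 (K : ℕ) [NeZero K] (hK : 3 ≤ K) (θ p : ℝ) (hθ : 0 < θ) (hp : 0 < p) :
    -- the QSD exists, is unique, and is the uniform distribution
    (∀ q : ZMod K → ℝ, FlemingViot.IsQSD K θ p q ↔ q = fun _ => 1 / (K : ℝ)) ∧
    -- the stationary distribution of the particle process exists and is unique
    (∀ N : ℕ, 2 ≤ N → ∃! ν : FlemingViot.Config K N → ℝ,
      FlemingViot.IsStationary (FlemingViot.generator K N θ p) ν) ∧
    -- the asymptotic bound
    (∃ r : ℕ → ℝ, r =o[Filter.atTop] (fun N : ℕ => 1 / Real.sqrt (N : ℝ)) ∧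
      ∀ N : ℕ, 2 ≤ N → ∀ ν : FlemingViot.Config K N → ℝ,
        FlemingViot.IsStationary (FlemingViot.generator K N θ p) ν →
        ∀ q : ZMod K → ℝ, FlemingViot.IsQSD K θ p q →
        FlemingViot.expectedDist ν q ≤
          Real.sqrt (((K : ℝ) - 1) / (N : ℝ)) *
            Real.sqrt (1 + p * ((K : ℝ) + 1) / (6 * (1 + θ))) + r N) ∧
    -- the rate of convergence
    (∃ C : ℝ, ∀ N : ℕ, 2 ≤ N → ∀ ν : FlemingViot.Config K N → ℝ,
        FlemingViot.IsStationary (FlemingViot.generator K N θ p) ν →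
        ∀ q : ZMod K → ℝ, FlemingViot.IsQSD K θ p q →
        FlemingViot.expectedDist ν q ≤ C / Real.sqrt (N : ℝ)) := by
  refine ⟨FlemingViot.isQSD_iff hθ, fun N hN => FlemingViot.existsUnique_isStationary hK hN hθ hp,
    -- The bound is non-asymptotic, so the error term is zero.
    ⟨fun _ => 0, Asymptotics.isLittleO_zero _ _, ?_⟩,
    ⟨Real.sqrt ((K : ℝ) - 1) * Real.sqrt (1 + p * ((K : ℝ) + 1) / (6 * (1 + θ))), ?_⟩⟩
  · intro N hN ν hν q hq
    rw [(FlemingViot.isQSD_iff hθ q).1 hq, add_zero]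
    exact FlemingViot.expectedDist_le hK hN hθ hp hν
  · intro N hN ν hν q hq
    rw [(FlemingViot.isQSD_iff hθ q).1 hq]
    have h := FlemingViot.expectedDist_le hK hN hθ hp hν
    rwa [Real.sqrt_div' _ (Nat.cast_nonneg N), div_mul_eq_mul_div] at h
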